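/- Let $n\ge 2$, let $M$ be a compact oriented $3$-manifold with boundary, and let $\widehat M$ be the space obtained from $M$ by collapsing each boundary component to a point. Let $\mathcal T$ be an oriented (topologically ideal) triangulation of $M$: an identification of $\widehat M$ with the space obtained from finitely many standard ordered $3$-simplices by gluing all their faces in pairs via orientation-reversing affine homeomorphisms, such that the $0$-cells are exactly the collapsed boundary components and the orientations of the simplices agree with that of $M$. Identify each simplex $\Delta$ of $\mathcal T$ with $\{x\in\mathbb R^4 : x_i\ge 0,\ x_0+x_1+x_2+x_3=n\}$, and for $m\geq 0$ let $\Delta^3_{m}(\mathbb Z)$ denote the set of $x\in\mathbb Z_{\ge 0}^4$ with $x_0+x_1+x_2+x_3=m$. An integral point of $\mathcal T$ is an equivalence class $p$ of pairs $(t,\Delta)$, $t\in\Delta^3_n(\mathbb Z)$, under the identifications generated by the face pairings; it is a vertex point if it is represented by a vertex of a simplex. A subsimplex of $\Delta$ is given by an element $s\in\Delta^3_{n-2}(\mathbb Z)$, and the edge of $s$ joining its vertices $i\neq j$ has midpoint $s+\varepsilon_{ij}$, where $\varepsilon_{ij}$ is the sum of the $i$-th and $j$-th standard basis vectors of $\mathbb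 R^4$ (indices $0,\dots,3$). To each subsimplex $s$ of each $\Delta$ assign a variable $z_{s,\Delta}$ and label its edges by $$z^{\varepsilon_{01}}=z^{\varepsilon_{23}}=z_{s,\Delta},\qquad z^{\varepsilon_{12}}=z^{\varepsilon_{03}}=\frac1{1-z_{s,\Delta}},\qquad z^{\varepsilon_{02}}=z^{\varepsilon_{13}}=1-\frac1{z_{s,\Delta}}.$$ The $\mathrm{PGL}(n,\mathbb C)$-gluing equation of a non-vertex integral point $p$ sets equal to $1$ the product of the labels of all edges of subsimplices having $p$ as midpoint; rewriting it as $$\prod_{(s,\Delta)} z_{s,\Delta}^{A_{p,(s,\Delta)}}\prod_{(s,\Delta)}(1-z_{s,\Delta})^{B_{p,(s,\Delta)}}=\pm1$$ defines integer matrices $A,B$ with rows indexed by the non-vertex integral points and columns indexed by the pairs $(s,\Delta)$. Then the rank of $(A\mid B)$ is the number of non-vertex integral points of $\mathcal T$ minus $c(n-1)$, where $c$ is the number of connected components of $\partial M$. -/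

import Mathlib

open scoped Manifold

/-- An orientation-consistent gluing of the faces, in pairs, of a collection of standard ordered
`3`-simplices indexed by `ι`.  The face `f : Fin 4` of a simplex is the one opposite to its
vertex `f`.  The face `f` of `Δ` is glued to a face of the simplex `nbr Δ f` by the affine
homeomorphism sending the vertex `i ≠ f` to the vertex `glue Δ f i`; the remaining value
`glue Δ f f` is the number of the target face.  The gluing reverses the induced orientations of
the two faces (so that the orientations of the simplices fit together) iff `glue Δ f` is odd. -/
structure OrientedGluing (ι : Type*) where
  nbr : ι → Fin 4 → ι
  glue : ι → Fin 4 → Equiv.Perm (Fin 4)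
  nbr_nbr : ∀ Δ f, nbr (nbr Δ f) (glue Δ f f) = Δ
  glue_glue : ∀ Δ f, glue (nbr Δ f) (glue Δ f f) = (glue Δ f)⁻¹
  ne_self : ∀ Δ f, (nbr Δ f, glue Δ f f) ≠ (Δ, f)
  sign_glue : ∀ Δ f, Equiv.Perm.sign (glue Δ f) = -1

namespace OrientedGluing

variable {ι : Type*}

/-- The point of `Δ` with barycentric coordinates `x` lies on some face and is glued by the
pairing of this face to the point of `Δ'` with coordinates `x'`. -/
def Glued (T : OrientedGluing ι) {R : Type*} [Zero R]
    (Δ : ι) (x : Fin 4 → R) (Δ' : ι) (x' : Fin 4 → R) : Prop :=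
  ∃ f : Fin 4, x f = 0 ∧ Δ' = T.nbr Δ f ∧ ∀ i, x' (T.glue Δ f i) = x i

/-- The space obtained from the disjoint union of the simplices by gluing the faces, with the
quotient topology. -/
def Realization (T : OrientedGluing ι) : Type _ :=
  Quot fun p q : (Σ _ : ι, stdSimplex ℝ (Fin 4)) =>
    T.Glued p.1 (p.2 : Fin 4 → ℝ) q.1 (q.2 : Fin 4 → ℝ)

instance (T : OrientedGluing ι) : TopologicalSpace T.Realization :=
  inferInstanceAs (TopologicalSpace (Quot _))

/-- The set of `0`-cells of the glued space, i.e. of images of vertices of the simplices. -/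
def zeroCells (T : OrientedGluing ι) : Set T.Realization :=
  {y | ∃ (Δ : ι) (x : stdSimplex ℝ (Fin 4)),
    (∃ i, (x : Fin 4 → ℝ) i = 1) ∧ y = Quot.mk _ ⟨Δ, x⟩}

end OrientedGluing

/-- The integral points `Δ³ₙ(ℤ)` of the simplex `x₀ + x₁ + x₂ + x₃ = n`, `xᵢ ≥ 0`. -/
def LatticePoint (n : ℕ) : Type := {t : Fin 4 → ℕ // ∑ i, t i = n}

/-- The subsimplices of `Δ³ₙ`, indexed by `Δ³ₙ₋₂(ℤ)`. -/
def Subsimplex (n : ℕ) : Type := {s : Fin 4 → ℕ // ∑ i, s i + 2 = n}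

instance (n : ℕ) : Finite (Subsimplex n) := by
  have h : ∀ (s : Subsimplex n) (i : Fin 4), s.1 i < n + 1 := fun s i => by
    have h1 := Finset.single_le_sum (f := s.1) (fun j _ => Nat.zero_le _) (Finset.mem_univ i)
    have h2 := s.2
    omega
  refine Finite.of_injective (β := Fin 4 → Fin (n + 1)) (fun s i => ⟨s.1 i, h s i⟩) ?_
  intro s s' e
  apply Subtype.ext
  funext i
  exact congrArg Fin.val (congrFun e i)

noncomputable instance (n : ℕ) : Fintype (Subsimplex n) := Fintype.ofFinite _

/-- The midpoint `s + ε_{ij}` of the edge `ij` of the subsimplex `s`. -/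
def Subsimplex.midpoint {n : ℕ} (s : Subsimplex n) (i j : Fin 4) : LatticePoint n :=
  ⟨s.1 + Pi.single i 1 + Pi.single j 1, by
    have h := s.2
    simp only [Pi.add_apply, Finset.sum_add_distrib, Finset.sum_pi_single', Finset.mem_univ,
      if_true]
    omega⟩

namespace OrientedGluing

variable {ι : Type*}

/-- The integral points of the triangulation: the integral points of all the simplices, up to
the equivalence relation generated by the face pairings. -/
def IntegralPoint (T : OrientedGluing ι) (n : ℕ) : Type _ :=
  Quot fun p q : ι × LatticePoint n => T.Glued p.1 p.2.1 q.1 q.2.1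

/-- An integral point is a vertex point if it is represented by a vertex of a simplex. -/
def IntegralPoint.IsVertex {T : OrientedGluing ι} {n : ℕ} (p : T.IntegralPoint n) : Prop :=
  ∃ (Δ : ι) (t : LatticePoint n), (∃ i, t.1 i = n) ∧ p = Quot.mk _ (Δ, t)

def NonVertexPoint (T : OrientedGluing ι) (n : ℕ) : Type _ :=
  {p : T.IntegralPoint n // ¬ p.IsVertex}

open Classical in
/-- `1` if `p` is (the class of) the midpoint of the edge `ij` of the subsimplex `s` of `Δ`,
and `0` otherwise. -/
noncomputable def incidence (T : OrientedGluing ι) {n : ℕ} (p : T.NonVertexPoint n)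
    (Δ : ι) (s : Subsimplex n) (i j : Fin 4) : ℤ :=
  if (Quot.mk _ (Δ, s.midpoint i j) : T.IntegralPoint n) = p.1 then 1 else 0

/-- Exponents of `z = z^{ε₀₁} = z^{ε₂₃}` in the gluing equation of `p`, which sets equal to `1`
the product of the shape parameters of all edges of subsimplices having `p` as midpoint. -/
noncomputable def expA (T : OrientedGluing ι) (n : ℕ) :
    Matrix (T.NonVertexPoint n) (ι × Subsimplex n) ℤ := fun p c =>
  T.incidence p c.1 c.2 0 1 + T.incidence p c.1 c.2 2 3

/-- Exponents of `z' = z^{ε₁₂} = z^{ε₀₃} = 1 / (1 - z)` in the gluing equations. -/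
noncomputable def expB (T : OrientedGluing ι) (n : ℕ) :
    Matrix (T.NonVertexPoint n) (ι × Subsimplex n) ℤ := fun p c =>
  T.incidence p c.1 c.2 1 2 + T.incidence p c.1 c.2 0 3

/-- Exponents of `z'' = z^{ε₀₂} = z^{ε₁₃} = 1 - 1 / z` in the gluing equations. -/
noncomputable def expC (T : OrientedGluing ι) (n : ℕ) :
    Matrix (T.NonVertexPoint n) (ι × Subsimplex n) ℤ := fun p c =>
  T.incidence p c.1 c.2 0 2 + T.incidence p c.1 c.2 1 3

/-- The matrix `A` of exponents of the `z_{s,Δ}` once `z'` and `z''` are expressed through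
`z` and `1 - z`. -/
noncomputable def matA (T : OrientedGluing ι) (n : ℕ) :
    Matrix (T.NonVertexPoint n) (ι × Subsimplex n) ℤ := T.expA n - T.expC n

/-- The matrix `B` of exponents of the `1 - z_{s,Δ}` once `z'` and `z''` are expressed through
`z` and `1 - z`. -/
noncomputable def matB (T : OrientedGluing ι) (n : ℕ) :
    Matrix (T.NonVertexPoint n) (ι × Subsimplex n) ℤ := T.expC n - T.expB n

/-- The gluing equation matrix `(A|B)`. -/
noncomputable def gluingMatrix (T : OrientedGluing ι) (n : ℕ) :
    Matrix (T.NonVertexPoint n) ((ι × Subsimplex n) ⊕ (ι × Subsimplex n)) ℤ :=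
  Matrix.fromCols (T.matA n) (T.matB n)

end OrientedGluing

section Manifold

variable (M : Type*) [TopologicalSpace M] [ChartedSpace (EuclideanHalfSpace 3) M]

/-- The boundary of a topological `3`-manifold with boundary. -/
abbrev manifoldBoundary : Set M := (𝓡∂ 3).boundary M

/-- Two points lie in the same connected component of the boundary of `M`. -/
def SameBoundaryComponent (x y : M) : Prop :=
  ∃ (hx : x ∈ manifoldBoundary M) (hy : y ∈ manifoldBoundary M),
    (ConnectedComponents.mk (⟨x, hx⟩ : manifoldBoundary M)) = ConnectedComponents.mk ⟨y, hy⟩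

/-- The space obtained from `M` by collapsing each boundary component to a point. -/
def CollapsedBoundary : Type _ := Quot (SameBoundaryComponent M)

instance : TopologicalSpace (CollapsedBoundary M) :=
  inferInstanceAs (TopologicalSpace (Quot _))

/-- The number of boundary components of `M`. -/
noncomputable def numBoundaryComponents : ℕ :=
  Nat.card (ConnectedComponents (manifoldBoundary M))

/-- An oriented topologically ideal triangulation of `M` with simplices indexed by `ι`: an
identification of `M` with its boundary components collapsed to points with a space obtained by
gluing simplices, such that the collapsed boundary components are exactly the `0`-cells.
The orientation of `M` is the one for which all the simplices are positively oriented. -/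
structure OrientedIdealTriangulation (ι : Type*) extends OrientedGluing ι where
  homeo : CollapsedBoundary M ≃ₜ toOrientedGluing.Realization
  image_boundary :
    (fun x : M => homeo (Quot.mk _ x)) '' manifoldBoundary M = toOrientedGluing.zeroCells

end Manifold

/-! The rank is the number of rows minus the dimension of the left kernel. A vector in the left
kernel, extended by zero to the vertex points, is a function on integral points whose sums over the
three pairs of opposite edges of each subsimplex agree. On one simplex this forces the form `∑ i, f
i (t i)` with `f i 0 = 0` (`exists_eq_sum_of_opposite_sums`). The values of the `f i` below `n` are
determined by the restriction to any face containing the vertex `i` (`eq_of_sum_eq_on_face`), so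
they agree across face pairings and depend only on the class of the vertex; vanishing at vertex
points gives `f i n = 0`. Conversely all such sums satisfy the conditions. So the left kernel is a
sum of copies of `ℚ^(n-1)`, one for each vertex class, and the vertex classes correspond to the
boundary components. -/

/-! ### Functions on the lattice points of one simplex. -/

/-- A function on the lattice points of a tetrahedron whose sums over opposite edges of each
subsimplex agree is a sum of functions of the individual barycentric coordinates. -/
theorem separated_of_opposite_sums {n : ℕ} (Φ : ℕ → ℕ → ℕ → ℚ)
    (h₁ : ∀ a b c, a + b + c + 2 ≤ n →
      Φ (a + 1) b c + Φ a (b + 1) (c + 1) = Φ a (b + 1) c + Φ (a + 1) b (c + 1))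
    (h₂ : ∀ a b c, a + b + c + 2 ≤ n →
      Φ a (b + 1) c + Φ (a + 1) b (c + 1) = Φ a b (c + 1) + Φ (a + 1) (b + 1) c) :
    ∃ p q r h : ℕ → ℚ, ∀ a b c, a + b + c ≤ n → Φ a b c = p a + q b + r c + h (a + b + c) := by
  -- By `h₁`, the difference in the direction `c` is unchanged under `(a, b + 1) → (a + 1, b)`, so
  -- it depends only on `a + b` and `c`. Likewise `h₂` makes the difference in the direction `a`
  -- depend only on `a` and `b + c`.
  have hc : ∀ b a c, a + b + c + 1 ≤ n →
      Φ a b (c + 1) - Φ a b c = Φ (a + b) 0 (c + 1) - Φ (a + b) 0 c := by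
    intro b
    induction b with
    | zero => intros; rfl
    | succ b ih =>
      intro a c hle
      have e₁ := h₁ a b c (by omega)
      have e₂ := ih (a + 1) c (by omega)
      rw [show a + 1 + b = a + (b + 1) by ring] at e₂
      linarith
  have L₁ : ∀ c a b, a + b + c ≤ n → Φ a b c - Φ a b 0 = Φ (a + b) 0 c - Φ (a + b) 0 0 := by
    intro c
    induction c with
    | zero => intros; simp
    | succ c ih =>
      intro a b hle
      have e₁ := hc b a c (by omega)
      have e₂ := ih a b (by omega)
      linarith
  have ha : ∀ c a b, a + b + c + 1 ≤ n →
      Φ (a + 1) b c - Φ a b c = Φ (a + 1) (b + c) 0 - Φ a (b + c) 0 := by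
    intro c
    induction c with
    | zero => intros; rfl
    | succ c ih =>
      intro a b hle
      have e₁ := h₂ a b c (by omega)
      have e₂ := ih a (b + 1) (by omega)
      rw [show b + 1 + c = b + (c + 1) by ring] at e₂
      linarith
  have L₃ : ∀ a b c, a + b + c ≤ n → Φ a b c - Φ 0 b c = Φ a (b + c) 0 - Φ 0 (b + c) 0 := by
    intro a
    induction a with
    | zero => intros; simp
    | succ a ih =>
      intro b c hle
      have e₁ := ha c a b (by omega)
      have e₂ := ih b c (by omega)
      linarith
  have hg : ∀ a c, a + c ≤ n → Φ a 0 c = Φ 0 0 c + Φ a c 0 - Φ 0 c 0 := by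
    intro a c hle
    have e := L₃ a 0 c (by omega)
    rw [Nat.zero_add] at e
    linarith
  -- Two evaluations of `Φ a b c`, through `L₁` and through `L₃`: the function `F` below is a
  -- normalized 2-cocycle on a truncation of `ℕ`, and `H` exhibits it as a coboundary.
  have cocycle : ∀ a b c, a + b + c ≤ n → Φ a b 0 + Φ (a + b) c 0 - Φ (a + b) 0 0 =
      Φ 0 b 0 + Φ b c 0 - Φ b 0 0 + Φ a (b + c) 0 - Φ 0 (b + c) 0 := by
    intro a b c hle
    have e₁ := L₁ c a b hle
    have e₂ := L₃ a b c hle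
    have e₃ := L₁ c 0 b (by omega)
    rw [Nat.zero_add] at e₃
    have e₄ := hg (a + b) c hle
    have e₅ := hg b c (by omega)
    linarith
  let F : ℕ → ℕ → ℚ := fun a b => Φ a b 0 - Φ a 0 0 - Φ 0 b 0 + Φ 0 0 0
  let H : ℕ → ℚ := fun m => ∑ k ∈ Finset.range m, F 1 k
  have hF : ∀ b c, b + c ≤ n → F b c = H (b + c) - H b - H c := by
    intro b
    induction b with
    | zero => intro c _; simp [F, H]
    | succ b ih =>
      intro c hle
      have e₁ := cocycle 1 b c (by omega)
      have e₂ := ih c (by omega)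
      have e₃ : H (b + 1 + c) = H (b + c) + F 1 (b + c) := by
        rw [show b + 1 + c = b + c + 1 by ring]; exact Finset.sum_range_succ _ _
      have e₄ : H (b + 1) = H b + F 1 b := Finset.sum_range_succ _ _
      rw [Nat.add_comm 1 b] at e₁
      simp only [F] at e₂ e₃ e₄ ⊢
      linarith
  refine ⟨fun a => Φ a 0 0 - H a - 2 * Φ 0 0 0, fun b => Φ 0 b 0 - H b, fun c => Φ 0 0 c - H c, H,
    fun a b c hle => ?_⟩
  have e₁ := L₁ c a b hle
  have e₂ := hg (a + b) c hle
  have e₃ := hF a b (by omega)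
  have e₄ := hF (a + b) c hle
  simp only [F] at e₃ e₄
  linarith

/-- Version of `separated_of_opposite_sums` in barycentric coordinates, with the functions
normalized to vanish at `0`. -/
theorem exists_eq_sum_of_opposite_sums {n : ℕ} (hn : 0 < n) (φ : (Fin 4 → ℕ) → ℚ)
    (h₁ : ∀ a b c d, a + b + c + d + 2 = n → φ ![a + 1, b, c, d + 1] + φ ![a, b + 1, c + 1, d] =
      φ ![a, b + 1, c, d + 1] + φ ![a + 1, b, c + 1, d])
    (h₂ : ∀ a b c d, a + b + c + d + 2 = n → φ ![a, b + 1, c, d + 1] + φ ![a + 1, b, c + 1, d] =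
      φ ![a, b, c + 1, d + 1] + φ ![a + 1, b + 1, c, d]) :
    ∃ f : Fin 4 → ℕ → ℚ, (∀ i, f i 0 = 0) ∧
      ∀ t : Fin 4 → ℕ, ∑ i, t i = n → φ t = ∑ i, f i (t i) := by
  obtain ⟨p, q, r, h, e⟩ := separated_of_opposite_sums (n := n)
    (fun a b c => φ ![a, b, c, n - (a + b + c)])
    (by
      intro a b c hle
      obtain ⟨d, rfl⟩ := Nat.exists_eq_add_of_le hle
      convert h₁ a b c d (by omega) using 5 <;> (congr 4; omega))
    (by
      intro a b c hle
      obtain ⟨d, rfl⟩ := Nat.exists_eq_add_of_le hle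
      convert h₂ a b c d (by omega) using 5 <;> (congr 4; omega))
  -- Since the coordinates sum to `n`, adding `K * t i` to every term adds the constant `K * n`,
  -- which compensates for the values at `0` subtracted below.
  let K : ℚ := (p 0 + q 0 + r 0 + h n) / n
  refine ⟨![fun a => p a - p 0 + K * a, fun b => q b - q 0 + K * b, fun c => r c - r 0 + K * c,
    fun d => h (n - d) - h n + K * d], fun i => by fin_cases i <;> simp, fun t ht => ?_⟩
  rw [Fin.sum_univ_four] at ht
  have ht' : t = ![t 0, t 1, t 2, n - (t 0 + t 1 + t 2)] := by
    ext i
    fin_cases i <;> simp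
    omega
  have e' := e (t 0) (t 1) (t 2) (by omega)
  rw [← ht'] at e'
  have hK : K * n = p 0 + q 0 + r 0 + h n := by
    have : (n : ℚ) ≠ 0 := by positivity
    simp only [K]; field_simp
  have hn' : (n : ℚ) = t 0 + t 1 + t 2 + t 3 := by exact_mod_cast ht.symm
  rw [e', Fin.sum_univ_four, show t 0 + t 1 + t 2 = n - t 3 by omega]
  rw [hn'] at hK
  simp
  linarith

/-- The edges `b = 0` and `a = 0` of the triangle give `f = g`, the points with `b = 1` then give `f
(a + 1) = f a + f 1`, and the edge `c = 0` forces the slope to satisfy `n * f 1 = 0`. -/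
theorem eq_zero_of_sum_eq_zero {n : ℕ} (f g h : ℕ → ℚ) (hf : f 0 = 0) (hg : g 0 = 0)
    (hh : h 0 = 0) (H : ∀ a b c, a < n → b < n → c < n → a + b + c = n → f a + g b + h c = 0)
    {a : ℕ} (ha : a < n) : f a = 0 := by
  have hfh : ∀ a, 0 < a → a < n → f a = - h (n - a) := fun a h0 h1 => by
    have := H a 0 (n - a) h1 (by omega) (by omega) (by omega)
    linarith
  have hgh : ∀ a, 0 < a → a < n → g a = - h (n - a) := fun a h0 h1 => by
    have := H 0 a (n - a) (by omega) h1 (by omega) (by omega)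
    linarith
  have lin : ∀ a, a < n → f a = a * f 1 := by
    intro a
    induction a with
    | zero => intro _; simp [hf]
    | succ a ih =>
      intro hlt
      have e₁ := H a 1 (n - (a + 1)) (by omega) (by omega) (by omega) (by omega)
      have e₂ := hfh (a + 1) (by omega) hlt
      have e₃ := hfh 1 (by omega) (by omega)
      have e₄ := hgh 1 (by omega) (by omega)
      have e₅ := ih (by omega)
      push_cast
      linarith
  rcases Nat.eq_zero_or_pos a with rfl | h0
  · exact hf
  have e₁ := H a (n - a) 0 ha (by omega) (by omega) (by omega)
  have e₂ := lin a ha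
  have e₃ := lin (n - a) (by omega)
  have e₄ := hfh (n - a) (by omega) (by omega)
  have e₅ := hgh (n - a) (by omega) (by omega)
  have e₆ : (a + (n - a : ℕ) : ℚ) * f 1 = 0 := by linarith
  have : (a + (n - a : ℕ) : ℚ) ≠ 0 := by positivity
  rw [e₂, (mul_eq_zero.1 e₆).resolve_left this, mul_zero]

theorem eq_of_sum_eq_on_face {n : ℕ} (f g : Fin 4 → ℕ → ℚ) (hf : ∀ i, f i 0 = 0)
    (hg : ∀ i, g i 0 = 0) (k : Fin 4)
    (H : ∀ t : Fin 4 → ℕ, ∑ i, t i = n → t k = 0 → ∑ i, f i (t i) = ∑ i, g i (t i))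
    {i : Fin 4} (hik : i ≠ k) {a : ℕ} (ha : a < n) : f i a = g i a := by
  obtain ⟨j, l, hij, hil, hjl, hjk, hlk⟩ : ∃ j l : Fin 4, i ≠ j ∧ i ≠ l ∧ j ≠ l ∧ j ≠ k ∧ l ≠ k := by
    clear H
    revert i k
    decide
  have huniv : (Finset.univ : Finset (Fin 4)) = {i, j, l, k} := by
    symm
    apply Finset.eq_univ_of_card
    simp [*]
  refine sub_eq_zero.1 (eq_zero_of_sum_eq_zero (n := n) (fun a => f i a - g i a)
    (fun a => f j a - g j a) (fun a => f l a - g l a) (by simp [hf, hg]) (by simp [hf, hg])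
    (by simp [hf, hg]) (fun a b c _ _ _ habc => ?_) ha)
  have := H (fun m => if m = i then a else if m = j then b else if m = l then c else 0)
  rw [huniv] at this
  simp [*, hij.symm, hil.symm, hjl.symm, hik.symm, hjk.symm, hlk.symm, ← add_assoc] at this
  linarith

/-! ### Vertex classes and 0-cells. -/

namespace OrientedGluing

variable {ι : Type*} (T : OrientedGluing ι)

/-- The vertices of the glued space: vertices of the simplices up to the face pairings. -/
def VertexClass : Type _ :=
  Quot fun p q : ι × Fin 4 => ∃ f, p.2 ≠ f ∧ q = (T.nbr p.1 f, T.glue p.1 f p.2)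

instance [Finite ι] : Finite T.VertexClass := inferInstanceAs (Finite (Quot _))

/-- The class of the vertex `i` of `Δ`. -/
def VertexClass.mk (Δ : ι) (i : Fin 4) : T.VertexClass := Quot.mk _ (Δ, i)

theorem VertexClass.mk_glue (Δ : ι) {i f : Fin 4} (h : i ≠ f) :
    mk T (T.nbr Δ f) (T.glue Δ f i) = mk T Δ i := (Quot.sound ⟨f, h, rfl⟩).symm

theorem VertexClass.exists_rep {T : OrientedGluing ι} (v : T.VertexClass) :
    ∃ Δ i, v = mk T Δ i := by
  obtain ⟨⟨Δ, i⟩, rfl⟩ := Quot.exists_rep v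
  exact ⟨Δ, i, rfl⟩

theorem eq_of_stdSimplex_apply_eq_one (x : stdSimplex ℝ (Fin 4)) {i j : Fin 4} (hi : x.1 i = 1)
    (hj : x.1 j = 1) : i = j := by
  by_contra h
  have h₁ := Finset.sum_le_sum_of_subset_of_nonneg (f := x.1) (Finset.subset_univ {i, j})
    (fun k _ _ => x.2.1 k)
  rw [Finset.sum_pair h, x.2.2, hi, hj] at h₁
  norm_num at h₁

open Classical in
/-- The vertex class of a `0`-cell of the glued space. -/
noncomputable def vertexClassOfPoint : T.Realization → Option T.VertexClass :=
  Quot.lift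
    (fun p => if h : ∃ i, p.2.1 i = 1 then some (VertexClass.mk T p.1 h.choose) else none) (by
      rintro ⟨Δ, x⟩ ⟨Δ', x'⟩ ⟨f, hf, hΔ, hx⟩
      obtain rfl : Δ' = T.nbr Δ f := hΔ
      replace hf : x.1 f = 0 := hf
      replace hx : ∀ i, x'.1 (T.glue Δ f i) = x.1 i := hx
      dsimp only
      by_cases h : ∃ i, x.1 i = 1
      · have h' : ∃ i, x'.1 i = 1 := ⟨_, (hx h.choose).trans h.choose_spec⟩
        rw [dif_pos h, dif_pos h', ← eq_of_stdSimplex_apply_eq_one x'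
          ((hx h.choose).trans h.choose_spec) h'.choose_spec]
        refine congrArg some (VertexClass.mk_glue T Δ ?_).symm
        intro e
        exact zero_ne_one (hf.symm.trans ((congrArg x.1 e).symm.trans h.choose_spec))
      · rw [dif_neg h, dif_neg]
        rintro ⟨i, hi⟩
        exact h ⟨(T.glue Δ f).symm i, by rw [← hx, Equiv.apply_symm_apply, hi]⟩)

theorem vertexClassOfPoint_mk (Δ : ι) (x : stdSimplex ℝ (Fin 4)) {i : Fin 4} (hi : x.1 i = 1) :
    T.vertexClassOfPoint (Quot.mk _ ⟨Δ, x⟩) = some (VertexClass.mk T Δ i) := by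
  have h : ∃ i, x.1 i = 1 := ⟨i, hi⟩
  refine (dif_pos h).trans ?_
  rw [eq_of_stdSimplex_apply_eq_one x hi h.choose_spec]

/-- The vertex of the standard simplex, as a point of it. -/
noncomputable def stdVertex (i : Fin 4) : stdSimplex ℝ (Fin 4) :=
  ⟨Pi.single i 1, single_mem_stdSimplex ℝ i⟩

theorem stdVertex_apply_self (i : Fin 4) : (stdVertex i).1 i = 1 := Pi.single_eq_same i 1

/-- The point of the glued space given by a vertex class. -/
noncomputable def pointOfVertexClass : T.VertexClass → T.Realization :=
  Quot.lift (fun p => Quot.mk _ ⟨p.1, stdVertex p.2⟩) (by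
    rintro ⟨Δ, i⟩ _ ⟨f, hf, rfl⟩
    refine Quot.sound ⟨f, Pi.single_eq_of_ne hf.symm 1, rfl, fun j => ?_⟩
    change (Pi.single _ 1 : Fin 4 → ℝ) _ = (Pi.single i 1 : Fin 4 → ℝ) j
    simp only [Pi.single_apply, EmbeddingLike.apply_eq_iff_eq])

theorem vertexClassOfPoint_pointOfVertexClass (v : T.VertexClass) :
    T.vertexClassOfPoint (T.pointOfVertexClass v) = some v := by
  obtain ⟨Δ, i, rfl⟩ := v.exists_rep
  exact T.vertexClassOfPoint_mk Δ _ (stdVertex_apply_self i)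

theorem range_pointOfVertexClass : Set.range T.pointOfVertexClass = T.zeroCells := by
  ext y
  constructor
  · rintro ⟨v, rfl⟩
    obtain ⟨Δ, i, rfl⟩ := v.exists_rep
    exact ⟨Δ, stdVertex i, ⟨i, stdVertex_apply_self i⟩, rfl⟩
  · rintro ⟨Δ, x, ⟨i, hi⟩, rfl⟩
    refine ⟨VertexClass.mk T Δ i, ?_⟩
    suffices stdVertex i = x by rw [← this]; rfl
    apply Subtype.ext
    funext j
    replace hi : x.1 i = 1 := hi
    have hs := x.2.2
    rw [← Finset.add_sum_erase _ _ (Finset.mem_univ i)] at hs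
    rw [hi, add_eq_left, Finset.sum_eq_zero_iff_of_nonneg fun k _ => x.2.1 k] at hs
    by_cases hji : j = i
    · rw [hji, stdVertex_apply_self, hi]
    · rw [show x.1 j = 0 from hs j (by simp [hji])]
      exact Pi.single_eq_of_ne hji 1

/-- `vertexClassOfPoint` is a left inverse of `pointOfVertexClass`: gluing all points of the faces
identifies no more vertices than gluing the vertices alone. -/
theorem card_vertexClass : Nat.card T.VertexClass = Nat.card T.zeroCells := by
  have hinj : Function.Injective T.pointOfVertexClass := fun v w h => by
    have := congrArg T.vertexClassOfPoint h
    simpa only [vertexClassOfPoint_pointOfVertexClass, Option.some.injEq] using this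
  rw [← range_pointOfVertexClass]
  exact Nat.card_congr (Equiv.ofInjective _ hinj)

end OrientedGluing

/-! ### Boundary components and vertex classes. -/

section Manifold

variable {M : Type*} [TopologicalSpace M] [ChartedSpace (EuclideanHalfSpace 3) M]

/-- The relation is symmetric and transitive but reflexive only on the boundary, so the equivalence
it generates adds nothing but equality. -/
theorem CollapsedBoundary.mk_eq_mk_iff {x y : M} (hx : x ∈ manifoldBoundary M) :
    (Quot.mk _ x : CollapsedBoundary M) = Quot.mk _ y ↔ SameBoundaryComponent M x y := by
  refine ⟨fun h => ?_, Quot.sound⟩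
  have h' := Quot.eqvGen_exact h
  suffices H : (x = y ∨ SameBoundaryComponent M x y) by
    rcases H with rfl | H
    exacts [⟨hx, hx, rfl⟩, H]
  clear h hx
  induction h' with
  | rel _ _ h => exact Or.inr h
  | refl => exact Or.inl rfl
  | symm _ _ _ ih =>
    rcases ih with rfl | ⟨hx, hy, e⟩
    exacts [Or.inl rfl, Or.inr ⟨hy, hx, e.symm⟩]
  | trans _ _ _ _ _ ih₁ ih₂ =>
    rcases ih₁ with rfl | ⟨hx, hy, e⟩
    · exact ih₂
    rcases ih₂ with rfl | ⟨hy', hz, e'⟩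
    exacts [Or.inr ⟨hx, hy, e⟩, Or.inr ⟨hx, hz, e.trans e'⟩]

theorem OrientedIdealTriangulation.numBoundaryComponents_eq {ι : Type*}
    (T : OrientedIdealTriangulation M ι) :
    numBoundaryComponents M = Nat.card T.VertexClass := by
  rw [OrientedGluing.card_vertexClass, ← T.image_boundary]
  let F : manifoldBoundary M → T.Realization := fun x => T.homeo (Quot.mk _ x.1)
  have hF : ∀ x y : manifoldBoundary M, F x = F y ↔
      (ConnectedComponents.mk x) = ConnectedComponents.mk y := fun x y => by
    refine T.homeo.injective.eq_iff.trans ((CollapsedBoundary.mk_eq_mk_iff x.2).trans ?_)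
    exact ⟨fun ⟨_, _, e⟩ => e, fun e => ⟨x.2, y.2, e⟩⟩
  refine Nat.card_congr (Equiv.ofBijective (β := ((fun x : M => T.homeo (Quot.mk _ x)) ''
    manifoldBoundary M : Set _))
    (fun c => ⟨F (Quotient.out c), _, (Quotient.out c).2, rfl⟩) ⟨fun c d h => ?_, ?_⟩)
  · have h' := (hF _ _).1 (congrArg Subtype.val h)
    exact (Quotient.out_eq c).symm.trans (h'.trans (Quotient.out_eq d))
  · rintro ⟨_, x, hx, rfl⟩
    refine ⟨ConnectedComponents.mk ⟨x, hx⟩, Subtype.ext ((hF _ ⟨x, hx⟩).2 ?_)⟩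
    exact Quotient.out_eq (ConnectedComponents.mk (⟨x, hx⟩ : manifoldBoundary M))

end Manifold

/-! ### Coordinates of lattice points. -/

/-- The barycentric coordinates of a lattice point. -/
def LatticePoint.coord {n : ℕ} (t : LatticePoint n) : Fin 4 → ℕ := t.1

theorem LatticePoint.sum_coord {n : ℕ} (t : LatticePoint n) : ∑ i, t.coord i = n := t.2

/-- The lattice point with given barycentric coordinates. -/
def LatticePoint.ofCoord {n : ℕ} (t : Fin 4 → ℕ) (h : ∑ i, t i = n) : LatticePoint n := ⟨t, h⟩

theorem LatticePoint.coord_ofCoord {n : ℕ} (t : Fin 4 → ℕ) (h : ∑ i, t i = n) :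
    (ofCoord t h).coord = t := rfl

/-- The coordinates of a subsimplex. -/
def Subsimplex.coord {n : ℕ} (s : Subsimplex n) : Fin 4 → ℕ := s.1

theorem Subsimplex.coord_midpoint {n : ℕ} (s : Subsimplex n) (i j : Fin 4) :
    (s.midpoint i j).coord = s.coord + Pi.single i 1 + Pi.single j 1 := rfl

theorem LatticePoint.coord_le {n : ℕ} (t : LatticePoint n) (i : Fin 4) : t.coord i ≤ n :=
  (Finset.single_le_sum (f := t.coord) (fun _ _ => Nat.zero_le _) (Finset.mem_univ i)).trans_eq
    t.sum_coord

instance (n : ℕ) : Finite (LatticePoint n) := by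
  refine Finite.of_injective (β := Fin 4 → Fin (n + 1))
    (fun t i => ⟨t.coord i, Nat.lt_succ_of_le (t.coord_le i)⟩) fun t t' e => Subtype.ext ?_
  funext i
  exact congrArg Fin.val (congrFun e i)

theorem LatticePoint.coord_eq_zero {n : ℕ} (t : LatticePoint n) {i j : Fin 4}
    (hi : t.coord i = n) (hij : j ≠ i) : t.coord j = 0 := by
  have h := t.sum_coord
  rw [← Finset.add_sum_erase _ _ (Finset.mem_univ i), hi, Nat.add_eq_left,
    Finset.sum_eq_zero_iff] at h
  exact h j (by simp [hij])

theorem LatticePoint.sum_eq {n : ℕ} (t : LatticePoint n) {i : Fin 4} (hi : t.coord i = n)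
    (f : Fin 4 → ℕ → ℚ) (hf : ∀ i, f i 0 = 0) : ∑ j, f j (t.coord j) = f i n := by
  rw [Finset.sum_eq_single i, hi]
  · intro j _ hji
    rw [t.coord_eq_zero hi hji, hf]
  · simp

/-- Extension of a function on `{1, …, n - 1}` by zero. -/
def extendCoeff {n : ℕ} (c : Fin (n - 1) → ℚ) (k : ℕ) : ℚ :=
  if h : 0 < k ∧ k < n then c ⟨k - 1, by omega⟩ else 0

theorem extendCoeff_zero {n : ℕ} (c : Fin (n - 1) → ℚ) : extendCoeff c 0 = 0 := by
  simp [extendCoeff]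

theorem extendCoeff_self {n : ℕ} (c : Fin (n - 1) → ℚ) : extendCoeff c n = 0 := by
  simp [extendCoeff]

theorem extendCoeff_succ {n : ℕ} (c : Fin (n - 1) → ℚ) (k : Fin (n - 1)) :
    extendCoeff c (k + 1) = c k := by
  have := k.2
  rw [extendCoeff, dif_pos (by omega)]
  rfl

/-! ### Potentials and the left kernel of the gluing matrix. -/

namespace OrientedGluing

variable {ι : Type*} (T : OrientedGluing ι) {n : ℕ}

instance [Finite ι] : Finite (T.IntegralPoint n) := inferInstanceAs (Finite (Quot _))

instance [Finite ι] : Finite (T.NonVertexPoint n) := inferInstanceAs (Finite {_p // _})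

/-- The integral point of the triangulation represented by a lattice point of `Δ`. -/
def IntegralPoint.mk (Δ : ι) (t : LatticePoint n) : T.IntegralPoint n := Quot.mk _ (Δ, t)

theorem IntegralPoint.exists_rep {T : OrientedGluing ι} (p : T.IntegralPoint n) :
    ∃ Δ t, p = mk T Δ t := by
  obtain ⟨⟨Δ, t⟩, rfl⟩ := Quot.exists_rep p
  exact ⟨Δ, t, rfl⟩

/-- The function on integral points given by functions of the barycentric coordinates, one for
each vertex class. -/
def potential (g : T.VertexClass → Fin (n - 1) → ℚ) : T.IntegralPoint n → ℚ :=
  Quot.lift (fun p => ∑ i, extendCoeff (g (VertexClass.mk T p.1 i)) (p.2.coord i)) (by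
    rintro ⟨Δ, t⟩ ⟨Δ', t'⟩ ⟨f, hf, hΔ, ht⟩
    obtain rfl : Δ' = T.nbr Δ f := hΔ
    replace hf : t.coord f = 0 := hf
    replace ht : ∀ i, t'.coord (T.glue Δ f i) = t.coord i := ht
    dsimp only
    rw [← Equiv.sum_comp (T.glue Δ f) fun i => extendCoeff (g (VertexClass.mk T _ i)) (t'.coord i)]
    refine Finset.sum_congr rfl fun i _ => ?_
    rw [ht]
    -- The vertex opposite to the glued face may change class, but its coordinate is `0` there,
    -- where every coefficient function vanishes.
    by_cases hi : i = f
    · rw [hi, hf, extendCoeff_zero, extendCoeff_zero]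
    · rw [VertexClass.mk_glue T Δ hi])

theorem potential_mk (g : T.VertexClass → Fin (n - 1) → ℚ) (Δ : ι) (t : LatticePoint n) :
    T.potential g (IntegralPoint.mk T Δ t) =
      ∑ i, extendCoeff (g (VertexClass.mk T Δ i)) (t.coord i) := rfl

theorem potential_of_isVertex (g : T.VertexClass → Fin (n - 1) → ℚ) {p : T.IntegralPoint n}
    (hp : p.IsVertex) : T.potential g p = 0 := by
  obtain ⟨Δ, t, ⟨i, hi⟩, rfl⟩ := hp
  exact (t.sum_eq hi (fun i => extendCoeff (g (VertexClass.mk T Δ i)))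
    fun _ => extendCoeff_zero _).trans (extendCoeff_self _)

theorem potential_add (g g' : T.VertexClass → Fin (n - 1) → ℚ) (p : T.IntegralPoint n) :
    T.potential (g + g') p = T.potential g p + T.potential g' p := by
  obtain ⟨Δ, t, rfl⟩ := p.exists_rep
  simp only [potential_mk, ← Finset.sum_add_distrib]
  refine Finset.sum_congr rfl fun i _ => ?_
  simp only [extendCoeff]
  split_ifs <;> simp

theorem potential_smul (r : ℚ) (g : T.VertexClass → Fin (n - 1) → ℚ) (p : T.IntegralPoint n) :
    T.potential (r • g) p = r • T.potential g p := by
  obtain ⟨Δ, t, rfl⟩ := p.exists_rep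
  simp only [potential_mk, Finset.smul_sum]
  refine Finset.sum_congr rfl fun i _ => ?_
  simp only [extendCoeff]
  split_ifs <;> simp

/-- `potential` as a linear map into functions on the non-vertex points. -/
def potentialMap (n : ℕ) :
    (T.VertexClass → Fin (n - 1) → ℚ) →ₗ[ℚ] (T.NonVertexPoint n → ℚ) where
  toFun g p := T.potential g p.1
  map_add' g g' := funext fun p => T.potential_add g g' p.1
  map_smul' r g := funext fun p => T.potential_smul r g p.1

theorem potentialMap_injective : Function.Injective (T.potentialMap n) := by
  intro g g' h
  have h' : ∀ p, T.potential g p = T.potential g' p := fun p => by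
    by_cases hp : p.IsVertex
    · rw [potential_of_isVertex _ _ hp, potential_of_isVertex _ _ hp]
    · exact congrFun h ⟨p, hp⟩
  funext v k
  obtain ⟨Δ, i, rfl⟩ := v.exists_rep
  obtain ⟨j, hj⟩ := exists_ne i
  have hk := k.2
  have := eq_of_sum_eq_on_face (n := n) (fun i => extendCoeff (g (VertexClass.mk T Δ i)))
    (fun i => extendCoeff (g' (VertexClass.mk T Δ i))) (fun _ => extendCoeff_zero _)
    (fun _ => extendCoeff_zero _) j (fun t ht _ => h' (IntegralPoint.mk T Δ (LatticePoint.ofCoord t ht))) hj.symm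
    (a := k + 1) (by omega)
  simpa only [extendCoeff_succ] using this

open Classical in
/-- Extension by zero of a function on non-vertex points to all integral points. -/
noncomputable def extendByZero (v : T.NonVertexPoint n → ℚ) (p : T.IntegralPoint n) : ℚ :=
  if h : ¬ p.IsVertex then v ⟨p, h⟩ else 0

theorem extendByZero_of_isVertex (v : T.NonVertexPoint n → ℚ) {p : T.IntegralPoint n}
    (hp : p.IsVertex) : T.extendByZero v p = 0 := dif_neg (not_not.2 hp)

theorem extendByZero_val (v : T.NonVertexPoint n → ℚ) (p : T.NonVertexPoint n) :
    T.extendByZero v p.1 = v p := dif_pos p.2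

theorem extendByZero_potentialMap (g : T.VertexClass → Fin (n - 1) → ℚ) :
    T.extendByZero (T.potentialMap n g) = T.potential g := by
  funext p
  by_cases hp : p.IsVertex
  · rw [extendByZero_of_isVertex _ _ hp, potential_of_isVertex _ _ hp]
  · exact T.extendByZero_val _ ⟨p, hp⟩

theorem incidence_eq_one {p : T.NonVertexPoint n} {Δ : ι} {s : Subsimplex n} {i j : Fin 4}
    (h : IntegralPoint.mk T Δ (s.midpoint i j) = p.1) : T.incidence p Δ s i j = 1 := if_pos h

theorem incidence_eq_zero {p : T.NonVertexPoint n} {Δ : ι} {s : Subsimplex n} {i j : Fin 4}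
    (h : IntegralPoint.mk T Δ (s.midpoint i j) ≠ p.1) : T.incidence p Δ s i j = 0 := if_neg h

theorem sum_incidence_mul [Fintype (T.NonVertexPoint n)] (v : T.NonVertexPoint n → ℚ) (Δ : ι)
    (s : Subsimplex n) (i j : Fin 4) :
    ∑ p, (T.incidence p Δ s i j : ℚ) * v p =
      T.extendByZero v (IntegralPoint.mk T Δ (s.midpoint i j)) := by
  by_cases hp : (IntegralPoint.mk T Δ (s.midpoint i j)).IsVertex
  · rw [extendByZero_of_isVertex _ _ hp]
    refine Finset.sum_eq_zero fun p _ => ?_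
    rw [incidence_eq_zero T fun e => p.2 (e ▸ hp), Int.cast_zero, zero_mul]
  · obtain ⟨q, hq⟩ : ∃ q : T.NonVertexPoint n, IntegralPoint.mk T Δ (s.midpoint i j) = q.1 :=
      ⟨⟨_, hp⟩, rfl⟩
    rw [Finset.sum_eq_single q, incidence_eq_one T hq, Int.cast_one, one_mul, hq,
      extendByZero_val]
    · intro p _ hne
      rw [incidence_eq_zero T fun e => hne (Subtype.ext (e.symm.trans hq)), Int.cast_zero, zero_mul]
    · exact fun h => absurd (Finset.mem_univ _) h

/-- The equality of the sums of a function on integral points over the three pairs of opposite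
edges of every subsimplex. -/
def OppositeSumsEq (w : T.IntegralPoint n → ℚ) : Prop :=
  ∀ (Δ : ι) (s : Subsimplex n),
    w (IntegralPoint.mk T Δ (s.midpoint 0 1)) + w (IntegralPoint.mk T Δ (s.midpoint 2 3)) =
      w (IntegralPoint.mk T Δ (s.midpoint 0 2)) + w (IntegralPoint.mk T Δ (s.midpoint 1 3)) ∧
    w (IntegralPoint.mk T Δ (s.midpoint 0 2)) + w (IntegralPoint.mk T Δ (s.midpoint 1 3)) =
      w (IntegralPoint.mk T Δ (s.midpoint 1 2)) + w (IntegralPoint.mk T Δ (s.midpoint 0 3))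

/-- The columns of `A` compare the edge pairs `01, 23` and `02, 13`; those of `B` compare `02, 13`
and `12, 03`. -/
theorem mem_ker_gluingMatrix_transpose_iff [Fintype ι] [Fintype (T.NonVertexPoint n)]
    (v : T.NonVertexPoint n → ℚ) :
    v ∈ LinearMap.ker ((T.gluingMatrix n).map (Int.cast : ℤ → ℚ)).transpose.mulVecLin ↔
      T.OppositeSumsEq (T.extendByZero v) := by
  rw [LinearMap.mem_ker, Matrix.mulVecLin_apply, funext_iff]
  simp only [Sum.forall, Prod.forall, OppositeSumsEq, forall_and]
  refine and_congr (forall₂_congr fun Δ s => ?_) (forall₂_congr fun Δ s => ?_)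
  · rw [← sub_eq_zero (b := T.extendByZero v _ + _), Pi.zero_apply]
    simp only [← sum_incidence_mul, ← Finset.sum_add_distrib, ← Finset.sum_sub_distrib]
    refine Eq.congr (Finset.sum_congr rfl fun p _ => ?_) rfl
    simp [gluingMatrix, matA, expA, expC]
    ring
  · rw [← sub_eq_zero (b := T.extendByZero v _ + _), Pi.zero_apply]
    simp only [← sum_incidence_mul, ← Finset.sum_add_distrib, ← Finset.sum_sub_distrib]
    refine Eq.congr (Finset.sum_congr rfl fun p _ => ?_) rfl
    simp [gluingMatrix, matB, expB, expC]
    ring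

/-- Each vertex of a subsimplex lies on exactly one edge of every opposite pair, so the coordinate
`i` contributes its function at `s i` and at `s i + 1` to all three sums. -/
theorem oppositeSumsEq_potential (g : T.VertexClass → Fin (n - 1) → ℚ) :
    T.OppositeSumsEq (T.potential g) := by
  intro Δ s
  simp only [potential_mk, Fin.sum_univ_four, Subsimplex.coord_midpoint, Pi.add_apply,
    Pi.single_apply]
  simp
  constructor <;> ring

theorem OppositeSumsEq.exists_eq_sum {T : OrientedGluing ι} (hn : 0 < n)
    {w : T.IntegralPoint n → ℚ} (hw : T.OppositeSumsEq w) (Δ : ι) :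
    ∃ f : Fin 4 → ℕ → ℚ, (∀ i, f i 0 = 0) ∧
      ∀ t : LatticePoint n, w (IntegralPoint.mk T Δ t) = ∑ i, f i (t.coord i) := by
  -- The value `0` off the hyperplane is a dummy: `φ` is only evaluated at coordinate sum `n`.
  let φ : (Fin 4 → ℕ) → ℚ := fun t => if h : ∑ i, t i = n then
    w (IntegralPoint.mk T Δ (LatticePoint.ofCoord t h)) else 0
  have hφ : ∀ (t : LatticePoint n) (t' : Fin 4 → ℕ), t.coord = t' →
      w (IntegralPoint.mk T Δ t) = φ t' := by
    rintro t _ rfl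
    change _ = dite _ _ _
    rw [dif_pos t.sum_coord]
    rfl
  have key : ∀ a b c d, a + b + c + d + 2 = n →
      φ ![a + 1, b + 1, c, d] + φ ![a, b, c + 1, d + 1] =
        φ ![a + 1, b, c + 1, d] + φ ![a, b + 1, c, d + 1] ∧
      φ ![a + 1, b, c + 1, d] + φ ![a, b + 1, c, d + 1] =
        φ ![a, b + 1, c + 1, d] + φ ![a + 1, b, c, d + 1] := by
    intro a b c d h
    obtain ⟨s, hs⟩ : ∃ s : Subsimplex n, s.coord = ![a, b, c, d] :=
      ⟨⟨![a, b, c, d], by simpa [Fin.sum_univ_four] using h⟩, rfl⟩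
    have := hw Δ s
    rw [hφ _ ![a + 1, b + 1, c, d], hφ _ ![a, b, c + 1, d + 1], hφ _ ![a + 1, b, c + 1, d],
      hφ _ ![a, b + 1, c, d + 1], hφ _ ![a, b + 1, c + 1, d], hφ _ ![a + 1, b, c, d + 1]] at this
    · exact this
    all_goals
      funext i
      rw [Subsimplex.coord_midpoint, hs]
      simp only [Pi.add_apply, Pi.single_apply]
      fin_cases i <;> simp
  obtain ⟨f, hf, e⟩ := exists_eq_sum_of_opposite_sums hn φ
    (fun a b c d h => by have := key a b c d h; linarith)
    (fun a b c d h => by have := key a b c d h; linarith)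
  exact ⟨f, hf, fun t => (hφ t t.coord rfl).trans (e t.coord t.sum_coord)⟩

theorem OppositeSumsEq.exists_eq_potential {T : OrientedGluing ι} (hn : 0 < n)
    {w : T.IntegralPoint n → ℚ} (hw : T.OppositeSumsEq w)
    (hv : ∀ p : T.IntegralPoint n, p.IsVertex → w p = 0) :
    ∃ g : T.VertexClass → Fin (n - 1) → ℚ, T.potential g = w := by
  choose f hf hfw using fun Δ => hw.exists_eq_sum hn Δ
  have hfn : ∀ Δ i, f Δ i n = 0 := fun Δ i => by
    let t : LatticePoint n := LatticePoint.ofCoord (Pi.single i n) (by simp)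
    have ht : t.coord i = n := Pi.single_eq_same (M := fun _ => ℕ) i n
    rw [← t.sum_eq ht (f Δ) (hf Δ), ← hfw]
    exact hv _ ⟨Δ, t, ⟨i, ht⟩, rfl⟩
  -- Both decompositions restrict to the same function on the common face, so uniqueness on a face
  -- matches them.
  have hglue : ∀ Δ k i, i ≠ k → ∀ a, a < n → f Δ i a = f (T.nbr Δ k) (T.glue Δ k i) a := by
    intro Δ k i hik a ha
    refine eq_of_sum_eq_on_face (f Δ) (fun i => f (T.nbr Δ k) (T.glue Δ k i)) (hf Δ)
      (fun _ => hf _ _) k (fun t ht htk => ?_) hik ha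
    have ht' : ∑ i, t ((T.glue Δ k).symm i) = n := by rw [Equiv.sum_comp (T.glue Δ k).symm t, ht]
    have e : IntegralPoint.mk T Δ (LatticePoint.ofCoord t ht) =
        IntegralPoint.mk T (T.nbr Δ k) (LatticePoint.ofCoord _ ht') :=
      Quot.sound ⟨k, htk, rfl, fun i => congrArg t ((T.glue Δ k).symm_apply_apply i)⟩
    have e' := (hfw Δ _).symm.trans ((congrArg w e).trans (hfw _ _))
    rw [← Equiv.sum_comp (T.glue Δ k) fun i => f (T.nbr Δ k) i _] at e'
    simpa [LatticePoint.coord_ofCoord] using e'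
  obtain ⟨g, hg⟩ : ∃ g : T.VertexClass → Fin (n - 1) → ℚ,
      ∀ Δ i k, g (VertexClass.mk T Δ i) k = f Δ i (k + 1) := by
    refine ⟨Quot.lift (fun p k => f p.1 p.2 (k + 1)) ?_, fun _ _ _ => rfl⟩
    rintro ⟨Δ, i⟩ _ ⟨k, hik, rfl⟩
    funext a
    have := a.2
    exact hglue Δ k i hik _ (by omega)
  refine ⟨g, funext fun p => ?_⟩
  obtain ⟨Δ, t, rfl⟩ := p.exists_rep
  rw [potential_mk, hfw]
  refine Finset.sum_congr rfl fun i _ => ?_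
  have hle := t.coord_le i
  rw [extendCoeff]
  split_ifs with h
  · rw [hg, Nat.sub_add_cancel h.1]
  · rcases (show t.coord i = 0 ∨ t.coord i = n by omega) with h' | h' <;> rw [h']
    exacts [(hf Δ i).symm, (hfn Δ i).symm]

theorem ker_gluingMatrix_transpose [Fintype ι] [Fintype (T.NonVertexPoint n)] (hn : 0 < n) :
    LinearMap.ker ((T.gluingMatrix n).map (Int.cast : ℤ → ℚ)).transpose.mulVecLin =
      LinearMap.range (T.potentialMap n) := by
  ext v
  rw [mem_ker_gluingMatrix_transpose_iff, LinearMap.mem_range]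
  constructor
  · intro h
    obtain ⟨g, hg⟩ := h.exists_eq_potential hn fun p => T.extendByZero_of_isVertex v
    refine ⟨g, funext fun p => ?_⟩
    rw [← T.extendByZero_val v p, ← hg]
    rfl
  · rintro ⟨g, rfl⟩
    rw [extendByZero_potentialMap]
    exact T.oppositeSumsEq_potential g

/-- Rank-nullity for the transpose, whose kernel is the injective image of the potentials. -/
theorem rank_gluingMatrix_add [Fintype ι] (hn : 0 < n) :
    ((T.gluingMatrix n).map (Int.cast : ℤ → ℚ)).rank + Nat.card T.VertexClass * (n - 1) =
      Nat.card (T.NonVertexPoint n) := by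
  have := Fintype.ofFinite (T.NonVertexPoint n)
  have := Fintype.ofFinite T.VertexClass
  have h := LinearMap.finrank_range_add_finrank_ker
    ((T.gluingMatrix n).map (Int.cast : ℤ → ℚ)).transpose.mulVecLin
  rw [T.ker_gluingMatrix_transpose hn, LinearMap.finrank_range_of_inj T.potentialMap_injective,
    Module.finrank_fintype_fun_eq_card, Module.finrank_pi_fintype] at h
  rw [← Matrix.rank_transpose, Nat.card_eq_fintype_card, Nat.card_eq_fintype_card, ← h]
  simp [Matrix.rank]

end OrientedGluing

theorem mainTheorem3 {M : Type*} [TopologicalSpace M] [T2Space M] [CompactSpace M]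
    [ChartedSpace (EuclideanHalfSpace 3) M] {ι : Type*} [Fintype ι]
    (T : OrientedIdealTriangulation M ι) (n : ℕ) (hn : 2 ≤ n) :
    ((((T.gluingMatrix n).map (Int.cast : ℤ → ℚ)).rank : ℕ) : ℤ) =
      (Nat.card (T.NonVertexPoint n) : ℤ) - (numBoundaryComponents M : ℤ) * ((n : ℤ) - 1) := by
  have h := T.rank_gluingMatrix_add (n := n) (by omega)
  rw [T.numBoundaryComponents_eq, ← h]
  push_cast [show 1 ≤ n by omega]
  ring
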